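/- Let $\mathcal A$ be a Desargues affine plane, that is, an affine plane (two distinct points lie on exactly one line; through a point off a line there is exactly one line not meeting it; there are three non-collinear points) in which Desargues' axiom holds in its parallel and in its central form. Let $O\neq I$ be two points and let $\ell^{OI}$ be the line through them, with the following operations on its points. To add $A$ and $B$, choose a point $B_1\notin \ell^{OI}$, let $P_1$ be the intersection of the parallel to $\ell^{OI}$ through $B_1$ with the parallel to $OB_1$ through $A$; then $A+B$ is the intersection of $\ell^{OI}$ with the parallel to $BB_1$ through $P_1$. To multiply, choose $B_1\notin\ell^{OI}$, let $P_1$ be the intersection of the line $OB_1$ with the parallel to $IB_1$ through $A$; then $A\cdot B$ is the intersection of $\ell^{OI}$ with the parallel to $BB_1$ through $P_1$. (The results do not depend on $B_1$; with these operations $\ell^{OI}$ is a skew field with zero $O$ and unit $I$.) For points $A,B,C$ of $\ell^{OI}$ with $B\neq C$ put $$r(A,B;C)=(B-C)^{-1}\cdot(A-C).$$ **Theorem.** Let $A,B,C\in\ell^{OI}$ with $B\neq C$, and let $\mu:\ell^{OI}\to\ell^{OI}$ be the Möbius transform $\mu(X)=r(X,B;C)$. Then $\mu(B)=I$, $\mu(C)=O$,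 and $$r(\mu(A),\mu(B);\mu(C))=r(A,B;C).$$ -/

import Mathlib

/-- An affine plane on the point set `P`; lines are sets of points. -/
structure AffinePlane (P : Type*) where
  lines : Set (Set P)
  existsUnique_line : ∀ A B : P, A ≠ B → ∃! l : Set P, l ∈ lines ∧ A ∈ l ∧ B ∈ l
  existsUnique_parallel : ∀ (A : P) (l : Set P), l ∈ lines → A ∉ l →
    ∃! m : Set P, m ∈ lines ∧ A ∈ m ∧ l ∩ m = ∅
  exists_noncollinear : ∃ A B C : P, A ≠ B ∧ A ≠ C ∧ B ≠ C ∧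
    ∀ l ∈ lines, ¬ (A ∈ l ∧ B ∈ l ∧ C ∈ l)

namespace AffinePlane

variable {P : Type*} (𝒜 : AffinePlane P)

/-- The line through `A` and `B` (meaningful for `A ≠ B`, see `line_mem`). -/
def line (A B : P) : Set P := {X | ∃ l ∈ 𝒜.lines, A ∈ l ∧ B ∈ l ∧ X ∈ l}

/-- Two lines are parallel if they are equal or do not meet. -/
def Parallel (l m : Set P) : Prop := l = m ∨ l ∩ m = ∅

/-- The line through `A` parallel to the line `l` (see `parallelThrough_spec`). -/
def parallelThrough (A : P) (l : Set P) : Set P :=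
  {X | ∃ m ∈ 𝒜.lines, A ∈ m ∧ Parallel l m ∧ X ∈ m}

/-- Desargues' axiom, in both its parallel and its central form: if the vertices of the triangles
`A B C` and `A' B' C'` lie respectively on three distinct lines `a`, `b`, `c` which are parallel,
or pass through a common point different from all the vertices, and if `AB ∥ A'B'` and
`BC ∥ B'C'`, then `AC ∥ A'C'`. -/
def DesarguesAxiom : Prop :=
  ∀ a ∈ 𝒜.lines, ∀ b ∈ 𝒜.lines, ∀ c ∈ 𝒜.lines, a ≠ b → a ≠ c → b ≠ c →
  ∀ A ∈ a, ∀ A' ∈ a, ∀ B ∈ b, ∀ B' ∈ b, ∀ C ∈ c, ∀ C' ∈ c,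
    ((Parallel a b ∧ Parallel b c ∧ Parallel a c) ∨
      ∃ V : P, V ∈ a ∧ V ∈ b ∧ V ∈ c ∧
        A ≠ V ∧ A' ≠ V ∧ B ≠ V ∧ B' ≠ V ∧ C ≠ V ∧ C' ≠ V) →
    Parallel (𝒜.line A B) (𝒜.line A' B') →
    Parallel (𝒜.line B C) (𝒜.line B' C') →
    Parallel (𝒜.line A C) (𝒜.line A' C')

variable {𝒜}

theorem line_eq {A B : P} (h : A ≠ B) {l : Set P} (hl : l ∈ 𝒜.lines) (hA : A ∈ l) (hB : B ∈ l) :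
    𝒜.line A B = l := by
  ext X
  constructor
  · rintro ⟨m, hm, hAm, hBm, hX⟩
    rwa [(𝒜.existsUnique_line A B h).unique ⟨hl, hA, hB⟩ ⟨hm, hAm, hBm⟩]
  · exact fun hX => ⟨l, hl, hA, hB, hX⟩

theorem line_mem {A B : P} (h : A ≠ B) :
    𝒜.line A B ∈ 𝒜.lines ∧ A ∈ 𝒜.line A B ∧ B ∈ 𝒜.line A B := by
  obtain ⟨l, ⟨hl, hA, hB⟩, -⟩ := 𝒜.existsUnique_line A B h
  rw [line_eq h hl hA hB]
  exact ⟨hl, hA, hB⟩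

theorem parallelThrough_eq {A : P} {l m : Set P} (hl : l ∈ 𝒜.lines) (hm : m ∈ 𝒜.lines)
    (hA : A ∈ m) (hp : Parallel l m) : 𝒜.parallelThrough A l = m := by
  ext X
  constructor
  · rintro ⟨n, hn, hAn, hln, hX⟩
    suffices h : n = m by rwa [← h]
    by_cases hAl : A ∈ l
    · have h1 : l = m := hp.resolve_right fun h => by
        have : A ∈ l ∩ m := ⟨hAl, hA⟩
        simp [h] at this
      have h2 : l = n := hln.resolve_right fun h => by
        have : A ∈ l ∩ n := ⟨hAl, hAn⟩
        simp [h] at this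
      rw [← h1, ← h2]
    · refine (𝒜.existsUnique_parallel A l hl hAl).unique
        ⟨hn, hAn, hln.resolve_left ?_⟩ ⟨hm, hA, hp.resolve_left ?_⟩
      · rintro rfl; exact hAl hAn
      · rintro rfl; exact hAl hA
  · exact fun hX => ⟨m, hm, hA, hp, hX⟩

theorem parallelThrough_spec (A : P) {l : Set P} (hl : l ∈ 𝒜.lines) :
    𝒜.parallelThrough A l ∈ 𝒜.lines ∧ A ∈ 𝒜.parallelThrough A l ∧
      Parallel l (𝒜.parallelThrough A l) := by
  by_cases hA : A ∈ l
  · rw [parallelThrough_eq hl hl hA (Or.inl rfl)]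
    exact ⟨hl, hA, Or.inl rfl⟩
  · obtain ⟨m, ⟨hm, hAm, h⟩, -⟩ := 𝒜.existsUnique_parallel A l hl hA
    rw [parallelThrough_eq hl hm hAm (Or.inr h)]
    exact ⟨hm, hAm, Or.inr h⟩

theorem Parallel.symm' {l m : Set P} (h : Parallel l m) : Parallel m l :=
  h.elim (fun h => Or.inl h.symm) (fun h => Or.inr (by rwa [Set.inter_comm]))

theorem Parallel.trans' {l m n : Set P} (hl : l ∈ 𝒜.lines) (hm : m ∈ 𝒜.lines)
    (hn : n ∈ 𝒜.lines) (h₁ : Parallel l m) (h₂ : Parallel m n) : Parallel l n := by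
  by_cases h : l ∩ n = ∅
  · exact Or.inr h
  · obtain ⟨X, hXl, hXn⟩ := Set.nonempty_iff_ne_empty.mpr h
    left
    rw [← parallelThrough_eq hm hl hXl h₁.symm', parallelThrough_eq hm hn hXn h₂]

theorem exists_mem_inter {l m : Set P} (h : ¬ Parallel l m) : ∃ X, X ∈ l ∧ X ∈ m :=
  Set.nonempty_iff_ne_empty.mpr fun e => h (Or.inr e)

/-- Two distinct lines through a common point are not parallel. -/
theorem not_parallel_line {V A B : P} {l : Set P} (hV : V ∈ l) (hA : A ∉ l)
    (hB : B = V) : ¬ Parallel l (𝒜.line B A) := by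
  subst hB
  have hne : B ≠ A := fun h => hA (h ▸ hV)
  rintro (h | h)
  · exact hA (h ▸ (line_mem hne).2.2)
  · have : B ∈ l ∩ 𝒜.line B A := ⟨hV, (line_mem hne).2.1⟩
    simp [h] at this

theorem exists_notMem {l : Set P} (hl : l ∈ 𝒜.lines) : ∃ X, X ∉ l := by
  obtain ⟨A, B, C, -, -, -, h⟩ := 𝒜.exists_noncollinear
  by_contra! hX
  exact h l hl ⟨hX A, hX B, hX C⟩

/-- Parallels to two non-parallel lines are not parallel. -/
theorem not_parallel_congr {l l' m m' : Set P} (hl : l ∈ 𝒜.lines) (hl' : l' ∈ 𝒜.lines)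
    (hm : m ∈ 𝒜.lines) (hm' : m' ∈ 𝒜.lines) (h₁ : Parallel l l') (h₂ : Parallel m m')
    (h : ¬ Parallel l m) : ¬ Parallel l' m' := fun h' =>
  h (Parallel.trans' hl hl' hm h₁ (Parallel.trans' hl' hm' hm h' h₂.symm'))

theorem parallel_self (l : Set P) : Parallel l l := Or.inl rfl

/-- A line of the plane with two distinct points `O`, `I` marked on it. -/
structure MarkedLine {P : Type*} (𝒜 : AffinePlane P) where
  O : P
  I : P
  ne : O ≠ I

namespace MarkedLine

variable (ℓ : 𝒜.MarkedLine)

/-- The point set of the line `OI`. -/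
def carrier : Set P := 𝒜.line ℓ.O ℓ.I

/-- The points of the line `OI`. -/
abbrev Pt : Type _ := {X : P // X ∈ ℓ.carrier}

/-- The point `O` of the line `OI`. -/
def origin : ℓ.Pt := ⟨ℓ.O, (line_mem ℓ.ne).2.1⟩

/-- The point `I` of the line `OI`. -/
def unit : ℓ.Pt := ⟨ℓ.I, (line_mem ℓ.ne).2.2⟩

/-- `C` is obtained from `A` and `B` by the addition construction: take `B₁` off the line `OI`;
let `P₁` be the common point of the parallel to `OI` through `B₁` and the parallel to `OB₁`
through `A`; then `C` is the common point of `OI` and the parallel to `BB₁` through `P₁`. -/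
def IsSum (A B C : ℓ.Pt) : Prop :=
  ∃ B₁ : P, B₁ ∉ ℓ.carrier ∧
  ∃ P₁ : P, P₁ ∈ 𝒜.parallelThrough B₁ ℓ.carrier ∩ 𝒜.parallelThrough A (𝒜.line ℓ.O B₁) ∧
    (C : P) ∈ 𝒜.parallelThrough P₁ (𝒜.line B B₁) ∩ ℓ.carrier

/-- `C` is obtained from `A` and `B` by the multiplication construction: take `B₁` off the line
`OI`; let `P₁` be the common point of the parallel to `IB₁` through `A` and the line `OB₁`;
then `C` is the common point of `OI` and the parallel to `BB₁` through `P₁`. -/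
def IsProd (A B C : ℓ.Pt) : Prop :=
  ∃ B₁ : P, B₁ ∉ ℓ.carrier ∧
  ∃ P₁ : P, P₁ ∈ 𝒜.parallelThrough A (𝒜.line ℓ.I B₁) ∩ 𝒜.line ℓ.O B₁ ∧
    (C : P) ∈ 𝒜.parallelThrough P₁ (𝒜.line B B₁) ∩ ℓ.carrier

theorem carrier_mem : ℓ.carrier ∈ 𝒜.lines := (line_mem ℓ.ne).1

theorem ne_of_notMem {ℓ : 𝒜.MarkedLine} (A : ℓ.Pt) {E : P} (hE : E ∉ ℓ.carrier) : (A : P) ≠ E :=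
  fun h => hE (h ▸ A.2)

theorem exists_isSum (A B : ℓ.Pt) : ∃ C, ℓ.IsSum A B C := by
  have hℓ := ℓ.carrier_mem
  obtain ⟨E, hE⟩ := exists_notMem hℓ
  have hOE := line_mem (𝒜 := 𝒜) (ne_of_notMem ℓ.origin hE)
  have hBE := line_mem (𝒜 := 𝒜) (ne_of_notMem B hE)
  have h1 := parallelThrough_spec E hℓ
  have h2 := parallelThrough_spec (A : P) hOE.1
  obtain ⟨Q, hQ1, hQ2⟩ := exists_mem_inter (not_parallel_congr hℓ h1.1 hOE.1 h2.1 h1.2.2 h2.2.2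
    (not_parallel_line ℓ.origin.2 hE rfl))
  have h3 := parallelThrough_spec Q hBE.1
  obtain ⟨C, hC1, hC2⟩ := exists_mem_inter (not_parallel_congr hℓ hℓ hBE.1 h3.1
    (parallel_self _) h3.2.2 (not_parallel_line B.2 hE rfl))
  exact ⟨⟨C, hC1⟩, E, hE, Q, ⟨hQ1, hQ2⟩, hC2, hC1⟩

theorem exists_isProd (A B : ℓ.Pt) : ∃ C, ℓ.IsProd A B C := by
  have hℓ := ℓ.carrier_mem
  obtain ⟨E, hE⟩ := exists_notMem hℓ
  have hOE := line_mem (𝒜 := 𝒜) (ne_of_notMem ℓ.origin hE)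
  have hIE := line_mem (𝒜 := 𝒜) (ne_of_notMem ℓ.unit hE)
  have hBE := line_mem (𝒜 := 𝒜) (ne_of_notMem B hE)
  have hn : ¬ Parallel (𝒜.line ℓ.I E) (𝒜.line ℓ.O E) := by
    rintro (h | h)
    · refine hE ?_
      have : ℓ.carrier = 𝒜.line ℓ.O E := line_eq ℓ.ne hOE.1 hOE.2.1 (h ▸ hIE.2.1)
      rw [this]
      exact hOE.2.2
    · have : E ∈ 𝒜.line ℓ.I E ∩ 𝒜.line ℓ.O E := ⟨hIE.2.2, hOE.2.2⟩
      simp [h] at this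
  have h2 := parallelThrough_spec (A : P) hIE.1
  obtain ⟨Q, hQ1, hQ2⟩ := exists_mem_inter (not_parallel_congr hIE.1 h2.1 hOE.1 hOE.1 h2.2.2
    (parallel_self _) hn)
  have h3 := parallelThrough_spec Q hBE.1
  obtain ⟨C, hC1, hC2⟩ := exists_mem_inter (not_parallel_congr hℓ hℓ hBE.1 h3.1
    (parallel_self _) h3.2.2 (not_parallel_line B.2 hE rfl))
  exact ⟨⟨C, hC1⟩, E, hE, Q, ⟨hQ1, hQ2⟩, hC2, hC1⟩

theorem exists_isSum_origin (A : ℓ.Pt) : ∃ B, ℓ.IsSum A B ℓ.origin := by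
  have hℓ := ℓ.carrier_mem
  obtain ⟨E, hE⟩ := exists_notMem hℓ
  have hOE := line_mem (𝒜 := 𝒜) (ne_of_notMem ℓ.origin hE)
  have h1 := parallelThrough_spec E hℓ
  have h2 := parallelThrough_spec (A : P) hOE.1
  obtain ⟨Q, hQ1, hQ2⟩ := exists_mem_inter (not_parallel_congr hℓ h1.1 hOE.1 h2.1 h1.2.2 h2.2.2
    (not_parallel_line ℓ.origin.2 hE rfl))
  have hQ : Q ∉ ℓ.carrier := fun hQ => by
    rcases h1.2.2 with h | h
    · exact hE (h ▸ h1.2.1)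
    · have : Q ∈ ℓ.carrier ∩ 𝒜.parallelThrough E ℓ.carrier := ⟨hQ, hQ1⟩
      simp [h] at this
  have hOQ := line_mem (𝒜 := 𝒜) (ne_of_notMem ℓ.origin hQ)
  have h3 := parallelThrough_spec E hOQ.1
  obtain ⟨B, hB1, hB2⟩ := exists_mem_inter (not_parallel_congr hℓ hℓ hOQ.1 h3.1
    (parallel_self _) h3.2.2 (not_parallel_line ℓ.origin.2 hQ rfl))
  have hBE := line_mem (𝒜 := 𝒜) (ne_of_notMem (⟨B, hB1⟩ : ℓ.Pt) hE)
  have e := line_eq (ne_of_notMem (⟨B, hB1⟩ : ℓ.Pt) hE) h3.1 hB2 h3.2.1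
  refine ⟨⟨B, hB1⟩, E, hE, Q, ⟨hQ1, hQ2⟩, ?_, ℓ.origin.2⟩
  rw [parallelThrough_eq hBE.1 hOQ.1 hOQ.2.2 (by rw [e]; exact h3.2.2.symm')]
  exact hOQ.2.1

theorem exists_isProd_unit (A : ℓ.Pt) (hA : A ≠ ℓ.origin) : ∃ B, ℓ.IsProd B A ℓ.unit := by
  have hℓ := ℓ.carrier_mem
  obtain ⟨E, hE⟩ := exists_notMem hℓ
  have hOE := line_mem (𝒜 := 𝒜) (ne_of_notMem ℓ.origin hE)
  have hIE := line_mem (𝒜 := 𝒜) (ne_of_notMem ℓ.unit hE)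
  have hAE := line_mem (𝒜 := 𝒜) (ne_of_notMem A hE)
  have hn : ¬ Parallel (𝒜.line A E) (𝒜.line ℓ.O E) := by
    rintro (h | h)
    · refine hE ?_
      have hAO : ℓ.O ≠ (A : P) := fun h => hA (Subtype.ext h.symm)
      have h1 := line_eq hAO hℓ ℓ.origin.2 A.2
      have h2 : 𝒜.line ℓ.O A = 𝒜.line ℓ.O E := line_eq hAO hOE.1 hOE.2.1 (h ▸ hAE.2.1)
      rw [← h1, h2]
      exact hOE.2.2
    · have : E ∈ 𝒜.line A E ∩ 𝒜.line ℓ.O E := ⟨hAE.2.2, hOE.2.2⟩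
      simp [h] at this
  have h2 := parallelThrough_spec ℓ.I hAE.1
  obtain ⟨Q, hQ1, hQ2⟩ := exists_mem_inter (not_parallel_congr hAE.1 h2.1 hOE.1 hOE.1 h2.2.2
    (parallel_self _) hn)
  have h3 := parallelThrough_spec Q hIE.1
  obtain ⟨B, hB1, hB2⟩ := exists_mem_inter (not_parallel_congr hℓ hℓ hIE.1 h3.1
    (parallel_self _) h3.2.2 (not_parallel_line ℓ.unit.2 hE rfl))
  refine ⟨⟨B, hB1⟩, E, hE, Q, ⟨?_, hQ2⟩, ?_, ℓ.unit.2⟩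
  · change Q ∈ 𝒜.parallelThrough B (𝒜.line ℓ.unit E)
    rw [parallelThrough_eq hIE.1 h3.1 hB2 h3.2.2]
    exact h3.2.1
  · rw [parallelThrough_eq hAE.1 h2.1 hQ1 h2.2.2]
    exact h2.2.1

/-- The sum `A + B` of points of `OI`: the point given by the addition construction (in a Desargues
plane it does not depend on the auxiliary point). -/
noncomputable instance : Add ℓ.Pt := ⟨fun A B => (ℓ.exists_isSum A B).choose⟩

/-- The product `A * B` of points of `OI`: the point given by the multiplication construction (in a
Desargues plane it does not depend on the auxiliary point). -/
noncomputable instance : Mul ℓ.Pt := ⟨fun A B => (ℓ.exists_isProd A B).choose⟩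

/-- The opposite point: `A + (-A) = O`. -/
noncomputable instance : Neg ℓ.Pt := ⟨fun A => (ℓ.exists_isSum_origin A).choose⟩

noncomputable instance : Sub ℓ.Pt := ⟨fun A B => A + -B⟩

open Classical in
/-- The inverse point: `A⁻¹ * A = I` for `A ≠ O`, with the convention `O⁻¹ = O`. -/
noncomputable instance : Inv ℓ.Pt :=
  ⟨fun A => if h : A ≠ ℓ.origin then (ℓ.exists_isProd_unit A h).choose else ℓ.origin⟩

/-- The ratio `r(A, B; C) = (B - C)⁻¹ (A - C)` of three points of `OI`. -/
noncomputable def ratio (A B C : ℓ.Pt) : ℓ.Pt := (B - C)⁻¹ * (A - C)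

/-- The Möbius transform `μ(X) = r(X, B; C)` of the line `OI`. -/
noncomputable def mobius (B C : ℓ.Pt) : ℓ.Pt → ℓ.Pt := fun X => ℓ.ratio X B C

end MarkedLine

end AffinePlane

/-!
Neither associativity nor distributivity is needed.  Since `μ(B) = b⁻¹ b` and `μ(C) = b⁻¹ (C - C)` with
`b = B - C`, the first two claims say that `C - C = O`, that `b ≠ O` and that `b⁻¹ b = I`; then the
third one is `(I - O)⁻¹ (μ(A) - O) = μ(A)`, which only uses `X - O = X`, `I⁻¹ = I` and `I X = X`.

The laws for `O` and `I` can be read off the constructions, whatever auxiliary point is used.  In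
contrast, `-C` and `b⁻¹` are obtained with one auxiliary point, while the sums and products
containing them are computed with others, so that `C - C = O`, `b⁻¹ b = I` and `b ≠ O` depend on the
constructions being independent of that point (`IsSumAt.change`, `IsProdAt.change`).  For points
`E`, `E'` lying on different lines parallel to `OI` (respectively through `O`), this is Desargues'
axiom used twice (`DesarguesAxiom.transfer`): once for the triangles formed by `E`, `E'` and `O`
(respectively `I`), and once for those formed by `E`, `E'` and `B`.  Otherwise one passes through a
third auxiliary point.  For the sum such a point is missing exactly in the plane of order two,
where the sum of two points different from `O` is always `O`.
-/

namespace AffinePlane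

variable {P : Type*} {𝒜 : AffinePlane P}

/-! ### Incidence in an affine plane -/

theorem line_comm (A B : P) : 𝒜.line A B = 𝒜.line B A := by
  ext X
  exact ⟨fun ⟨l, hl, hA, hB, hX⟩ => ⟨l, hl, hB, hA, hX⟩,
    fun ⟨l, hl, hA, hB, hX⟩ => ⟨l, hl, hB, hA, hX⟩⟩

theorem Parallel.eq_of_mem {l m : Set P} {X : P} (h : Parallel l m) (hl : X ∈ l) (hm : X ∈ m) :
    l = m :=
  h.resolve_right fun e => by
    have : X ∈ l ∩ m := ⟨hl, hm⟩
    simp [e] at this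

theorem ne_of_mem_of_notMem {l : Set P} {X Y : P} (hX : X ∈ l) (hY : Y ∉ l) : X ≠ Y :=
  fun h => hY (h ▸ hX)

theorem eq_of_mem_line {k : Set P} {X Y Q : P} (hk : k ∈ 𝒜.lines) (hX : X ∈ k) (hY : Y ∈ k)
    (hQ : Q ∉ k) (h : X ∈ 𝒜.line Y Q) : X = Y := by
  by_contra hne
  have hYQ := line_mem (𝒜 := 𝒜) (ne_of_mem_of_notMem hY hQ)
  apply hQ
  rw [← line_eq hne hk hX hY, line_eq hne hYQ.1 h hYQ.2.1]
  exact hYQ.2.2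

/-- A line in a given direction through a point off `k` meets `k` at most once. -/
theorem eq_of_parallel_line {l k : Set P} {X Y Q : P} (hl : l ∈ 𝒜.lines) (hk : k ∈ 𝒜.lines)
    (hX : X ∈ k) (hY : Y ∈ k) (hQ : Q ∉ k) (h₁ : Parallel l (𝒜.line X Q))
    (h₂ : Parallel l (𝒜.line Y Q)) : X = Y := by
  have hXQ := line_mem (𝒜 := 𝒜) (ne_of_mem_of_notMem hX hQ)
  have hYQ := line_mem (𝒜 := 𝒜) (ne_of_mem_of_notMem hY hQ)
  have e := (Parallel.trans' hXQ.1 hl hYQ.1 h₁.symm' h₂).eq_of_mem hXQ.2.2 hYQ.2.2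
  exact eq_of_mem_line hk hX hY hQ (e ▸ hXQ.2.1)

theorem mem_parallelThrough_iff {l : Set P} {X Q : P} (hl : l ∈ 𝒜.lines) (h : X ≠ Q) :
    Q ∈ 𝒜.parallelThrough X l ↔ Parallel l (𝒜.line X Q) := by
  have hs := parallelThrough_spec X hl
  have hXQ := line_mem (𝒜 := 𝒜) h
  constructor
  · intro hQ
    rw [line_eq h hs.1 hs.2.1 hQ]
    exact hs.2.2
  · intro hp
    rw [parallelThrough_eq hl hXQ.1 hXQ.2.1 hp]
    exact hXQ.2.2

/-- A line in the direction of `l` through a point off `m` meets `m` if `l` is not parallel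
to `m`. -/
theorem exists_parallel_line {l m : Set P} {X : P} (hl : l ∈ 𝒜.lines) (hm : m ∈ 𝒜.lines)
    (hX : X ∉ m) (h : ¬ Parallel l m) : ∃ Q ∈ m, Parallel l (𝒜.line X Q) := by
  have hs := parallelThrough_spec X hl
  obtain ⟨Q, hQ, hQm⟩ := exists_mem_inter
    (not_parallel_congr hl hs.1 hm hm hs.2.2 (parallel_self m) h)
  exact ⟨Q, hQm, (mem_parallelThrough_iff hl (ne_of_mem_of_notMem hQm hX).symm).1 hQ⟩

theorem notMem_of_mem_parallelThrough {l : Set P} {E Q : P} (hl : l ∈ 𝒜.lines) (hE : E ∉ l)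
    (hQ : Q ∈ 𝒜.parallelThrough E l) : Q ∉ l := fun h => by
  have hs := parallelThrough_spec E hl
  exact hE (hs.2.2.eq_of_mem h hQ ▸ hs.2.1)

/-- Two lines joining distinct points of `k` to a common point off `k` are not parallel. -/
theorem not_parallel_line_line {k : Set P} {X Y Q : P} (hk : k ∈ 𝒜.lines) (hX : X ∈ k)
    (hY : Y ∈ k) (hQ : Q ∉ k) (hne : X ≠ Y) : ¬ Parallel (𝒜.line X Q) (𝒜.line Y Q) := fun h =>
  hne (eq_of_parallel_line (line_mem (ne_of_mem_of_notMem hX hQ)).1 hk hX hY hQ (parallel_self _) h)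

/-- The change of auxiliary point from `E` to `F`: Desargues' axiom gives `EF ∥ QR` for the
triangles `E X F` and `Q X' R`, and then `YF ∥ Y'R` for the triangles `Y E F` and `Y' Q R`. -/
theorem DesarguesAxiom.transfer (h𝒜 : 𝒜.DesarguesAxiom) {a k b : Set P} (ha : a ∈ 𝒜.lines)
    (hk : k ∈ 𝒜.lines) (hb : b ∈ 𝒜.lines) (hak : a ≠ k) (hab : a ≠ b) (hkb : k ≠ b)
    {E Q X X' Y Y' F R : P} (hE : E ∈ a) (hQ : Q ∈ a) (hX : X ∈ k) (hX' : X' ∈ k) (hY : Y ∈ k)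
    (hY' : Y' ∈ k) (hF : F ∈ b) (hR : R ∈ b)
    (hconf : (Parallel a k ∧ Parallel k b ∧ Parallel a b) ∨
      ∃ V : P, V ∈ a ∧ V ∈ k ∧ V ∈ b ∧ E ≠ V ∧ Q ≠ V ∧ X ≠ V ∧ X' ≠ V ∧ Y ≠ V ∧ Y' ≠ V ∧
        F ≠ V ∧ R ≠ V)
    (h₁ : Parallel (𝒜.line X E) (𝒜.line X' Q)) (h₂ : Parallel (𝒜.line X F) (𝒜.line X' R))
    (h₃ : Parallel (𝒜.line Y E) (𝒜.line Y' Q)) : Parallel (𝒜.line Y F) (𝒜.line Y' R) := by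
  have hEF : Parallel (𝒜.line E F) (𝒜.line Q R) := by
    refine h𝒜 a ha k hk b hb hak hab hkb E hE Q hQ X hX X' hX' F hF R hR ?_ ?_ h₂
    · rcases hconf with h | ⟨V, hVa, hVk, hVb, hEV, hQV, hXV, hXV', -, -, hFV, hRV⟩
      · exact Or.inl h
      · exact Or.inr ⟨V, hVa, hVk, hVb, hEV, hQV, hXV, hXV', hFV, hRV⟩
    · rwa [line_comm E, line_comm Q]
  refine h𝒜 k hk a ha b hb hak.symm hkb hab Y hY Y' hY' E hE Q hQ F hF R hR ?_ h₃ hEF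
  rcases hconf with ⟨h1, h2, h3⟩ | ⟨V, hVa, hVk, hVb, hEV, hQV, -, -, hYV, hYV', hFV, hRV⟩
  · exact Or.inl ⟨h1.symm', h3, h2⟩
  · exact Or.inr ⟨V, hVk, hVa, hVb, hYV, hYV', hEV, hQV, hFV, hRV⟩

namespace MarkedLine

variable {ℓ : 𝒜.MarkedLine}

theorem line_pt_mem (A : ℓ.Pt) {E : P} (hE : E ∉ ℓ.carrier) : 𝒜.line A E ∈ 𝒜.lines :=
  (line_mem (ne_of_notMem A hE)).1

theorem eq_of_parallel_pt {l : Set P} (hl : l ∈ 𝒜.lines) {A B : ℓ.Pt} {Q : P} (hQ : Q ∉ ℓ.carrier)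
    (h₁ : Parallel l (𝒜.line A Q)) (h₂ : Parallel l (𝒜.line B Q)) : A = B :=
  Subtype.ext (eq_of_parallel_line hl ℓ.carrier_mem A.2 B.2 hQ h₁ h₂)

theorem origin_ne_unit : ℓ.origin ≠ ℓ.unit := fun h => ℓ.ne (congrArg Subtype.val h)

/-! ### Addition with a given auxiliary point -/

/-- The addition construction with auxiliary point `E` off `OI` leads from `A` and `B` to `C`: the
lines joining `A` and `C` to some point `Q` of the parallel to `OI` through `E` are parallel to `OE`
and `BE`. -/
def IsSumAt (ℓ : 𝒜.MarkedLine) (E : P) (A B C : ℓ.Pt) : Prop :=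
  ∃ Q ∈ 𝒜.parallelThrough E ℓ.carrier,
    Parallel (𝒜.line ℓ.origin E) (𝒜.line A Q) ∧ Parallel (𝒜.line B E) (𝒜.line C Q)

theorem IsSum.exists_isSumAt {A B C : ℓ.Pt} (h : ℓ.IsSum A B C) :
    ∃ E ∉ ℓ.carrier, ℓ.IsSumAt E A B C := by
  obtain ⟨E, hE, Q, ⟨hQ, hAQ⟩, hCQ, -⟩ := h
  have hQℓ := notMem_of_mem_parallelThrough ℓ.carrier_mem hE hQ
  refine ⟨E, hE, Q, hQ, ?_, ?_⟩
  · exact (mem_parallelThrough_iff (line_pt_mem ℓ.origin hE) (ne_of_notMem A hQℓ)).1 hAQ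
  · rw [line_comm (C : P)]
    exact (mem_parallelThrough_iff (line_pt_mem B hE) (ne_of_notMem C hQℓ).symm).1 hCQ

theorem notMem_parallelThrough (A : ℓ.Pt) {E : P} (hE : E ∉ ℓ.carrier) :
    (A : P) ∉ 𝒜.parallelThrough E ℓ.carrier := fun h =>
  notMem_of_mem_parallelThrough ℓ.carrier_mem hE h A.2

/-- A line joining a point of `OI` to a point of the parallel to `OI` through `E` is determined by
its first point and its direction. -/
theorem eq_of_parallel_of_mem_parallelThrough {l : Set P} (hl : l ∈ 𝒜.lines) {A : ℓ.Pt} {E Q R : P}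
    (hE : E ∉ ℓ.carrier) (hQ : Q ∈ 𝒜.parallelThrough E ℓ.carrier)
    (hR : R ∈ 𝒜.parallelThrough E ℓ.carrier)
    (h₁ : Parallel l (𝒜.line A Q)) (h₂ : Parallel l (𝒜.line A R)) : Q = R := by
  rw [line_comm] at h₁ h₂
  exact eq_of_parallel_line hl (parallelThrough_spec E ℓ.carrier_mem).1 hQ hR
    (notMem_parallelThrough A hE) h₁ h₂

theorem exists_parallel_of_parallelThrough (A B : ℓ.Pt) {E : P} (hE : E ∉ ℓ.carrier) :
    ∃ Q ∈ 𝒜.parallelThrough E ℓ.carrier, Parallel (𝒜.line B E) (𝒜.line A Q) := by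
  have hs := parallelThrough_spec E ℓ.carrier_mem
  refine exists_parallel_line (line_pt_mem B hE) hs.1 (notMem_parallelThrough A hE) fun h => ?_
  have e := h.eq_of_mem (line_mem (ne_of_notMem B hE)).2.2 hs.2.1
  exact notMem_parallelThrough B hE (e ▸ (line_mem (ne_of_notMem B hE)).2.1)

theorem exists_parallel_pt (B : ℓ.Pt) {E Q : P} (hE : E ∉ ℓ.carrier) (hQ : Q ∉ ℓ.carrier) :
    ∃ C : ℓ.Pt, Parallel (𝒜.line B E) (𝒜.line C Q) := by
  obtain ⟨C, hC, h⟩ := exists_parallel_line (line_pt_mem B hE) ℓ.carrier_mem hQ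
    fun h => not_parallel_line B.2 hE rfl h.symm'
  exact ⟨⟨C, hC⟩, by rwa [line_comm C]⟩

theorem exists_isSumAt (A B : ℓ.Pt) {E : P} (hE : E ∉ ℓ.carrier) : ∃ C, ℓ.IsSumAt E A B C := by
  obtain ⟨Q, hQ, h⟩ := exists_parallel_of_parallelThrough A ℓ.origin hE
  obtain ⟨C, hC⟩ := exists_parallel_pt B hE (notMem_of_mem_parallelThrough ℓ.carrier_mem hE hQ)
  exact ⟨C, Q, hQ, h, hC⟩

theorem IsSumAt.unique {E : P} {A B C D : ℓ.Pt} (hE : E ∉ ℓ.carrier) (h₁ : ℓ.IsSumAt E A B C)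
    (h₂ : ℓ.IsSumAt E A B D) : C = D := by
  obtain ⟨Q, hQ, hAQ, hCQ⟩ := h₁
  obtain ⟨R, hR, hAR, hDR⟩ := h₂
  obtain rfl := eq_of_parallel_of_mem_parallelThrough (line_pt_mem ℓ.origin hE) hE hQ hR hAQ hAR
  exact eq_of_parallel_pt (line_pt_mem B hE)
    (notMem_of_mem_parallelThrough ℓ.carrier_mem hE hQ) hCQ hDR

theorem IsSumAt.right_cancel {E : P} {A B C D : ℓ.Pt} (hE : E ∉ ℓ.carrier)
    (h₁ : ℓ.IsSumAt E A C D) (h₂ : ℓ.IsSumAt E B C D) : A = B := by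
  obtain ⟨Q, hQ, hAQ, hDQ⟩ := h₁
  obtain ⟨R, hR, hBR, hDR⟩ := h₂
  obtain rfl := eq_of_parallel_of_mem_parallelThrough (line_pt_mem C hE) hE hQ hR hDQ hDR
  exact eq_of_parallel_pt (line_pt_mem ℓ.origin hE)
    (notMem_of_mem_parallelThrough ℓ.carrier_mem hE hQ) hAQ hBR

theorem isSumAt_origin_left (A : ℓ.Pt) (E : P) : ℓ.IsSumAt E ℓ.origin A A :=
  ⟨E, ⟨𝒜.parallelThrough E ℓ.carrier, (parallelThrough_spec E ℓ.carrier_mem).1,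
    (parallelThrough_spec E ℓ.carrier_mem).2.1, (parallelThrough_spec E ℓ.carrier_mem).2.2,
    (parallelThrough_spec E ℓ.carrier_mem).2.1⟩, parallel_self _, parallel_self _⟩

theorem isSumAt_origin_right (A : ℓ.Pt) {E : P} (hE : E ∉ ℓ.carrier) :
    ℓ.IsSumAt E A ℓ.origin A := by
  obtain ⟨Q, hQ, h⟩ := exists_parallel_of_parallelThrough A ℓ.origin hE
  exact ⟨Q, hQ, h, h⟩

/-- If `OI` and its parallel `m` through `E` contain all points, the sum of two points different
from `O` is `O`: the line `CQ` is parallel to `BE`, so it meets `OE`, whose only points are `O` and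
`E`; and it does not contain `E`, because its point on `m` is `Q ≠ E`. -/
theorem IsSumAt.eq_origin {E : P} {A B C : ℓ.Pt} (hE : E ∉ ℓ.carrier)
    (hall : ∀ X, X ∈ ℓ.carrier ∨ X ∈ 𝒜.parallelThrough E ℓ.carrier)
    (h : ℓ.IsSumAt E A B C) (hA : A ≠ ℓ.origin) (hB : B ≠ ℓ.origin) : C = ℓ.origin := by
  have hs := parallelThrough_spec E ℓ.carrier_mem
  -- Two lines transversal to `OI` that meet share their point on `OI` or their point on `m`.
  have key : ∀ {U V : ℓ.Pt} {Q R : P}, Q ∈ 𝒜.parallelThrough E ℓ.carrier →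
      R ∈ 𝒜.parallelThrough E ℓ.carrier → ¬ Parallel (𝒜.line U Q) (𝒜.line V R) →
      U = V ∨ Q = R := by
    intro U V Q R hQ hR hn
    obtain ⟨X, hXQ, hXR⟩ := exists_mem_inter hn
    have hQℓ := notMem_of_mem_parallelThrough ℓ.carrier_mem hE hQ
    have hRℓ := notMem_of_mem_parallelThrough ℓ.carrier_mem hE hR
    rcases hall X with hX | hX
    · exact Or.inl (Subtype.ext ((eq_of_mem_line ℓ.carrier_mem hX U.2 hQℓ hXQ).symm.trans
        (eq_of_mem_line ℓ.carrier_mem hX V.2 hRℓ hXR)))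
    · rw [line_comm] at hXQ hXR
      exact Or.inr ((eq_of_mem_line hs.1 hX hQ (notMem_parallelThrough U hE) hXQ).symm.trans
        (eq_of_mem_line hs.1 hX hR (notMem_parallelThrough V hE) hXR))
  obtain ⟨Q, hQ, hAQ, hCQ⟩ := h
  have hQℓ := notMem_of_mem_parallelThrough ℓ.carrier_mem hE hQ
  have hQE : Q ≠ E := by
    rintro rfl
    exact hA (eq_of_parallel_pt (line_pt_mem ℓ.origin hE) hE hAQ (parallel_self _))
  have hn : ¬ Parallel (𝒜.line ℓ.origin E) (𝒜.line B E) :=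
    not_parallel_line_line ℓ.carrier_mem ℓ.origin.2 B.2 hE fun e => hB (Subtype.ext e.symm)
  exact (key hQ hs.2.1 fun h => hn (Parallel.trans' (line_pt_mem B hE) (line_pt_mem C hQℓ)
    (line_pt_mem ℓ.origin hE) hCQ h).symm').resolve_right hQE

theorem IsSumAt.change_of_notMem (h𝒜 : 𝒜.DesarguesAxiom) {E F : P} {A B C : ℓ.Pt}
    (hE : E ∉ ℓ.carrier) (hF : F ∉ ℓ.carrier) (hEF : F ∉ 𝒜.parallelThrough E ℓ.carrier)
    (h : ℓ.IsSumAt E A B C) : ℓ.IsSumAt F A B C := by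
  obtain ⟨Q, hQ, hAQ, hCQ⟩ := h
  obtain ⟨R, hR, hAR⟩ := exists_parallel_of_parallelThrough A ℓ.origin hF
  have hs := parallelThrough_spec E ℓ.carrier_mem
  have ht := parallelThrough_spec F ℓ.carrier_mem
  exact ⟨R, hR, hAR, h𝒜.transfer hs.1 ℓ.carrier_mem ht.1 (fun e => hE (e ▸ hs.2.1))
    (fun e => hEF (e ▸ ht.2.1)) (fun e => hF (e ▸ ht.2.1)) hs.2.1 hQ ℓ.origin.2 A.2 B.2 C.2
    ht.2.1 hR (Or.inl ⟨hs.2.2.symm', ht.2.2,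
      Parallel.trans' hs.1 ℓ.carrier_mem ht.1 hs.2.2.symm' ht.2.2⟩) hAQ hAR hCQ⟩

/-- The sum does not depend on the auxiliary point. -/
theorem IsSumAt.change (h𝒜 : 𝒜.DesarguesAxiom) {E F : P} {A B C : ℓ.Pt}
    (hE : E ∉ ℓ.carrier) (hF : F ∉ ℓ.carrier) (h : ℓ.IsSumAt E A B C) : ℓ.IsSumAt F A B C := by
  by_cases hEF : F ∈ 𝒜.parallelThrough E ℓ.carrier
  swap
  · exact h.change_of_notMem h𝒜 hE hF hEF
  have hs := parallelThrough_spec E ℓ.carrier_mem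
  have e : 𝒜.parallelThrough F ℓ.carrier = 𝒜.parallelThrough E ℓ.carrier :=
    parallelThrough_eq ℓ.carrier_mem hs.1 hEF hs.2.2
  by_cases hall : ∀ X, X ∈ ℓ.carrier ∨ X ∈ 𝒜.parallelThrough E ℓ.carrier
  · by_cases hA : A = ℓ.origin
    · subst hA
      rw [h.unique hE (isSumAt_origin_left B E)]
      exact isSumAt_origin_left B F
    by_cases hB : B = ℓ.origin
    · subst hB
      rw [h.unique hE (isSumAt_origin_right A hE)]
      exact isSumAt_origin_right A hF
    obtain ⟨D, hD⟩ := exists_isSumAt A B hF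
    rwa [h.eq_origin hE hall hA hB, ← hD.eq_origin hF (e ▸ hall) hA hB]
  · push Not at hall
    obtain ⟨G, hG, hGE⟩ := hall
    refine (h.change_of_notMem h𝒜 hE hG hGE).change_of_notMem h𝒜 hG hF fun hFG => hGE ?_
    have ht := parallelThrough_spec G ℓ.carrier_mem
    rw [← e, parallelThrough_eq ℓ.carrier_mem ht.1 hFG ht.2.2]
    exact ht.2.1

/-! ### Multiplication with a given auxiliary point -/

/-- The multiplication construction with auxiliary point `E` off `OI` leads from `A` and `B` to `C`,
for `A ≠ O`: the lines joining `A` and `C` to some point `Q ≠ O` of `OE` are parallel to `IE` and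
`BE`. -/
def IsProdAt (ℓ : 𝒜.MarkedLine) (E : P) (A B C : ℓ.Pt) : Prop :=
  ∃ Q ∈ 𝒜.line ℓ.origin E, Q ∉ ℓ.carrier ∧
    Parallel (𝒜.line ℓ.unit E) (𝒜.line A Q) ∧ Parallel (𝒜.line B E) (𝒜.line C Q)

theorem eq_origin_of_mem_line {A : ℓ.Pt} {E : P} (hE : E ∉ ℓ.carrier)
    (h : (A : P) ∈ 𝒜.line ℓ.origin E) : A = ℓ.origin :=
  Subtype.ext (eq_of_mem_line ℓ.carrier_mem A.2 ℓ.origin.2 hE h)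

theorem notMem_line_origin {A : ℓ.Pt} (hA : A ≠ ℓ.origin) {E : P} (hE : E ∉ ℓ.carrier) :
    (A : P) ∉ 𝒜.line ℓ.origin E := fun h => hA (eq_origin_of_mem_line hE h)

/-- The construction is one in the sense of `IsProdAt` unless its point on `OE` is `O`, which
happens only if `A` and `C` are both `O`. -/
theorem IsProd.exists_isProdAt {A B C : ℓ.Pt} (h : ℓ.IsProd A B C)
    (hAC : A ≠ ℓ.origin ∨ C ≠ ℓ.origin) :
    ∃ E ∉ ℓ.carrier, ℓ.IsProdAt E A B C := by
  obtain ⟨E, hE, Q, ⟨hAQ, hQ⟩, hCQ, -⟩ := h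
  have hB := line_mem (𝒜 := 𝒜) (ne_of_notMem B hE)
  have hQℓ : Q ∉ ℓ.carrier := fun hQℓ => by
    obtain rfl : Q = ℓ.origin := congrArg Subtype.val (eq_origin_of_mem_line (A := ⟨Q, hQℓ⟩) hE hQ)
    rcases hAC with hA | hC
    · have hne : (A : P) ≠ ℓ.origin := fun e => hA (Subtype.ext e)
      have hp := (mem_parallelThrough_iff (line_pt_mem ℓ.unit hE) hne).1 hAQ
      rw [line_eq hne ℓ.carrier_mem A.2 ℓ.origin.2] at hp
      exact not_parallel_line ℓ.unit.2 hE rfl hp.symm'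
    · have hne : (ℓ.origin : P) ≠ C := fun e => hC (Subtype.ext e.symm)
      have hp := (mem_parallelThrough_iff hB.1 hne).1 hCQ
      rw [line_eq hne ℓ.carrier_mem ℓ.origin.2 C.2] at hp
      exact not_parallel_line B.2 hE rfl hp.symm'
  refine ⟨E, hE, Q, hQ, hQℓ, ?_, ?_⟩
  · exact (mem_parallelThrough_iff (line_pt_mem ℓ.unit hE) (ne_of_notMem A hQℓ)).1 hAQ
  · rw [line_comm (C : P)]
    exact (mem_parallelThrough_iff hB.1 (ne_of_notMem C hQℓ).symm).1 hCQ

/-- A line joining a point `A ≠ O` of `OI` to a point of `OE` is determined by `A` and its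
direction. -/
theorem eq_of_parallel_of_mem_line {l : Set P} (hl : l ∈ 𝒜.lines) {A : ℓ.Pt} (hA : A ≠ ℓ.origin)
    {E Q R : P} (hE : E ∉ ℓ.carrier) (hQ : Q ∈ 𝒜.line ℓ.origin E) (hR : R ∈ 𝒜.line ℓ.origin E)
    (h₁ : Parallel l (𝒜.line A Q)) (h₂ : Parallel l (𝒜.line A R)) : Q = R := by
  rw [line_comm] at h₁ h₂
  exact eq_of_parallel_line hl (line_pt_mem ℓ.origin hE) hQ hR (notMem_line_origin hA hE) h₁ h₂

theorem IsProdAt.ne_origin_left {E : P} {A B C : ℓ.Pt} (hE : E ∉ ℓ.carrier)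
    (h : ℓ.IsProdAt E A B C) : A ≠ ℓ.origin := by
  rintro rfl
  obtain ⟨Q, hQ, hQℓ, hAQ, -⟩ := h
  have hO := line_mem (𝒜 := 𝒜) (ne_of_notMem ℓ.origin hE)
  rw [line_eq (ne_of_notMem ℓ.origin hQℓ) hO.1 hO.2.1 hQ] at hAQ
  exact origin_ne_unit (eq_of_parallel_pt (line_pt_mem ℓ.origin hE) hE (parallel_self _) hAQ.symm')

theorem IsProdAt.eq_origin_iff {E : P} {A B C : ℓ.Pt} (hE : E ∉ ℓ.carrier)
    (h : ℓ.IsProdAt E A B C) : C = ℓ.origin ↔ B = ℓ.origin := by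
  obtain ⟨Q, hQ, hQℓ, -, hCQ⟩ := h
  have hO := line_mem (𝒜 := 𝒜) (ne_of_notMem ℓ.origin hE)
  have e := line_eq (ne_of_notMem ℓ.origin hQℓ) hO.1 hO.2.1 hQ
  constructor
  · rintro rfl
    rw [e] at hCQ
    exact eq_of_parallel_pt hO.1 hE hCQ.symm' (parallel_self _)
  · rintro rfl
    exact eq_of_parallel_pt hO.1 hQℓ hCQ (by rw [e]; exact parallel_self _)

theorem IsProdAt.unique {E : P} {A B C D : ℓ.Pt} (hE : E ∉ ℓ.carrier) (h₁ : ℓ.IsProdAt E A B C)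
    (h₂ : ℓ.IsProdAt E A B D) : C = D := by
  have hA := h₁.ne_origin_left hE
  obtain ⟨Q, hQ, hQℓ, hAQ, hCQ⟩ := h₁
  obtain ⟨R, hR, -, hAR, hDR⟩ := h₂
  obtain rfl := eq_of_parallel_of_mem_line (line_pt_mem ℓ.unit hE) hA hE hQ hR hAQ hAR
  exact eq_of_parallel_pt (line_pt_mem B hE) hQℓ hCQ hDR

theorem IsProdAt.change_of_notMem (h𝒜 : 𝒜.DesarguesAxiom) {E F : P} {A B C : ℓ.Pt}
    (hE : E ∉ ℓ.carrier) (hF : F ∉ ℓ.carrier) (hEF : F ∉ 𝒜.line ℓ.origin E) (hC : C ≠ ℓ.origin)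
    (h : ℓ.IsProdAt E A B C) : ℓ.IsProdAt F A B C := by
  have hA := h.ne_origin_left hE
  have hB := fun e => hC ((h.eq_origin_iff hE).2 e)
  obtain ⟨Q, hQ, hQℓ, hAQ, hCQ⟩ := h
  have hOE := line_mem (𝒜 := 𝒜) (ne_of_notMem ℓ.origin hE)
  have hOF := line_mem (𝒜 := 𝒜) (ne_of_notMem ℓ.origin hF)
  obtain ⟨R, hR, hAR⟩ := exists_parallel_line (line_pt_mem ℓ.unit hF) hOF.1
    (notMem_line_origin hA hF) (not_parallel_line_line ℓ.carrier_mem ℓ.unit.2 ℓ.origin.2 hF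
      ℓ.ne.symm)
  have hRO : R ≠ ℓ.origin := by
    rintro rfl
    rw [line_eq (fun e => hA (Subtype.ext e)) ℓ.carrier_mem A.2 ℓ.origin.2] at hAR
    exact not_parallel_line ℓ.unit.2 hF rfl hAR.symm'
  have hRℓ : R ∉ ℓ.carrier := fun h =>
    hRO (congrArg Subtype.val (eq_origin_of_mem_line (A := ⟨R, h⟩) hF hR))
  refine ⟨R, hR, hRℓ, hAR, h𝒜.transfer hOE.1 ℓ.carrier_mem hOF.1 (fun e => hE (e ▸ hOE.2.2))
    (fun e => hEF (e ▸ hOF.2.2)) (fun e => hF (e ▸ hOF.2.2)) hOE.2.2 hQ ℓ.unit.2 A.2 B.2 C.2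
    hOF.2.2 hR (Or.inr ⟨ℓ.origin, hOE.2.1, ℓ.origin.2, hOF.2.1, (ne_of_notMem ℓ.origin hE).symm,
      (ne_of_notMem ℓ.origin hQℓ).symm, ℓ.ne.symm, fun e => hA (Subtype.ext e),
      fun e => hB (Subtype.ext e), fun e => hC (Subtype.ext e),
      (ne_of_notMem ℓ.origin hF).symm, hRO⟩) hAQ hAR hCQ⟩

/-- There is always a point off `OI` and `OE`: the fourth vertex of the parallelogram
spanned by `OI` and `OE`. -/
theorem exists_notMem_notMem_line {E : P} (hE : E ∉ ℓ.carrier) :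
    ∃ G ∉ ℓ.carrier, G ∉ 𝒜.line ℓ.origin E := by
  obtain ⟨G, hG, h⟩ := exists_parallel_of_parallelThrough ℓ.unit ℓ.origin hE
  have hGℓ := notMem_of_mem_parallelThrough ℓ.carrier_mem hE hG
  have hIG := line_mem (𝒜 := 𝒜) (ne_of_notMem ℓ.unit hGℓ)
  refine ⟨G, hGℓ, fun hGE => notMem_line_origin origin_ne_unit.symm hE ?_⟩
  rw [h.eq_of_mem hGE hIG.2.2]
  exact hIG.2.1

/-- A product different from `O` does not depend on the auxiliary point. -/
theorem IsProdAt.change (h𝒜 : 𝒜.DesarguesAxiom) {E F : P} {A B C : ℓ.Pt}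
    (hE : E ∉ ℓ.carrier) (hF : F ∉ ℓ.carrier) (hC : C ≠ ℓ.origin)
    (h : ℓ.IsProdAt E A B C) : ℓ.IsProdAt F A B C := by
  by_cases hEF : F ∈ 𝒜.line ℓ.origin E
  swap
  · exact h.change_of_notMem h𝒜 hE hF hEF hC
  obtain ⟨G, hG, hGE⟩ := exists_notMem_notMem_line hE
  refine (h.change_of_notMem h𝒜 hE hG hGE hC).change_of_notMem h𝒜 hG hF (fun hFG => hGE ?_) hC
  have hOE := line_mem (𝒜 := 𝒜) (ne_of_notMem ℓ.origin hE)
  have hOG := line_mem (𝒜 := 𝒜) (ne_of_notMem ℓ.origin hG)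
  rw [← line_eq (ne_of_notMem ℓ.origin hF) hOE.1 hOE.2.1 hEF,
    line_eq (ne_of_notMem ℓ.origin hF) hOG.1 hOG.2.1 hFG]
  exact hOG.2.2

/-! ### The laws for the chosen operations -/

theorem isSum_add (A B : ℓ.Pt) : ℓ.IsSum A B (A + B) := (ℓ.exists_isSum A B).choose_spec

theorem isSum_neg (A : ℓ.Pt) : ℓ.IsSum A (-A) ℓ.origin := (ℓ.exists_isSum_origin A).choose_spec

theorem isProd_mul (A B : ℓ.Pt) : ℓ.IsProd A B (A * B) := (ℓ.exists_isProd A B).choose_spec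

theorem isProd_inv {A : ℓ.Pt} (hA : A ≠ ℓ.origin) : ℓ.IsProd A⁻¹ A ℓ.unit := by
  have e : A⁻¹ = (ℓ.exists_isProd_unit A hA).choose := dif_pos hA
  rw [e]
  exact (ℓ.exists_isProd_unit A hA).choose_spec

theorem add_origin (A : ℓ.Pt) : A + ℓ.origin = A := by
  obtain ⟨E, hE, h⟩ := (isSum_add A ℓ.origin).exists_isSumAt
  exact h.unique hE (isSumAt_origin_right A hE)

theorem neg_origin : -ℓ.origin = ℓ.origin := by
  obtain ⟨E, hE, h⟩ := (isSum_neg ℓ.origin).exists_isSumAt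
  exact (h.unique hE (isSumAt_origin_left _ E)).symm

theorem sub_origin (A : ℓ.Pt) : A - ℓ.origin = A := by
  change A + -ℓ.origin = A
  rw [neg_origin, add_origin]

theorem sub_self_eq_origin (h𝒜 : 𝒜.DesarguesAxiom) (A : ℓ.Pt) : A - A = ℓ.origin := by
  obtain ⟨E, hE, h⟩ := (isSum_neg A).exists_isSumAt
  obtain ⟨F, hF, h'⟩ := (isSum_add A (-A)).exists_isSumAt
  exact h'.unique hF (h.change h𝒜 hE hF)

theorem sub_ne_origin (h𝒜 : 𝒜.DesarguesAxiom) {A B : ℓ.Pt} (hAB : A ≠ B) : A - B ≠ ℓ.origin := by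
  intro h0
  obtain ⟨E, hE, h⟩ := (isSum_neg B).exists_isSumAt
  obtain ⟨F, hF, h'⟩ := (isSum_add A (-B)).exists_isSumAt
  rw [show A + -B = ℓ.origin from h0] at h'
  exact hAB (h'.right_cancel hF (h.change h𝒜 hE hF))

theorem mul_origin (A : ℓ.Pt) : A * ℓ.origin = ℓ.origin := by
  by_contra h0
  obtain ⟨E, hE, h⟩ := (isProd_mul A ℓ.origin).exists_isProdAt (Or.inr h0)
  exact h0 ((h.eq_origin_iff hE).2 rfl)

theorem isProdAt_unit_left (A : ℓ.Pt) {E : P} (hE : E ∉ ℓ.carrier) : ℓ.IsProdAt E ℓ.unit A A :=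
  ⟨E, (line_mem (ne_of_notMem ℓ.origin hE)).2.2, hE, parallel_self _, parallel_self _⟩

theorem inv_mul_self (h𝒜 : 𝒜.DesarguesAxiom) {A : ℓ.Pt} (hA : A ≠ ℓ.origin) :
    A⁻¹ * A = ℓ.unit := by
  obtain ⟨E, hE, h⟩ := (isProd_inv hA).exists_isProdAt (Or.inr origin_ne_unit.symm)
  obtain ⟨F, hF, h'⟩ := (isProd_mul A⁻¹ A).exists_isProdAt (Or.inl (h.ne_origin_left hE))
  exact h'.unique hF (h.change h𝒜 hE hF origin_ne_unit.symm)

theorem unit_mul (A : ℓ.Pt) : ℓ.unit * A = A := by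
  obtain ⟨E, hE, h⟩ := (isProd_mul ℓ.unit A).exists_isProdAt (Or.inl origin_ne_unit.symm)
  exact h.unique hE (isProdAt_unit_left A hE)

theorem inv_unit : (ℓ.unit)⁻¹ = ℓ.unit := by
  obtain ⟨E, hE, Q, hQ, hQℓ, hXQ, hIQ⟩ :=
    (isProd_inv origin_ne_unit.symm).exists_isProdAt (ℓ := ℓ)
      (Or.inr origin_ne_unit.symm)
  exact eq_of_parallel_pt (line_pt_mem ℓ.unit hE) hQℓ hXQ hIQ

end MarkedLine

end AffinePlane

open AffinePlane MarkedLine in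
theorem mainTheorem10 {P : Type*} (𝒜 : AffinePlane P) (h𝒜 : 𝒜.DesarguesAxiom)
    (ℓ : 𝒜.MarkedLine) (A B C : ℓ.Pt) (hBC : B ≠ C) :
    ℓ.mobius B C B = ℓ.unit ∧
    ℓ.mobius B C C = ℓ.origin ∧
    ℓ.ratio (ℓ.mobius B C A) (ℓ.mobius B C B) (ℓ.mobius B C C) = ℓ.ratio A B C := by
  have hB : ℓ.mobius B C B = ℓ.unit := inv_mul_self h𝒜 (sub_ne_origin h𝒜 hBC)
  have hC : ℓ.mobius B C C = ℓ.origin := by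
    change (B - C)⁻¹ * (C - C) = ℓ.origin
    rw [sub_self_eq_origin h𝒜, mul_origin]
  refine ⟨hB, hC, ?_⟩
  rw [hB, hC]
  change (ℓ.unit - ℓ.origin)⁻¹ * (ℓ.ratio A B C - ℓ.origin) = ℓ.ratio A B C
  rw [sub_origin, sub_origin, inv_unit, unit_mul]
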